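/- For a topological group $G$, a discrete $G$-module is an abelian group $A$ with the discrete topology and an action of $G$ by automorphisms such that $G\times A\to A$ is continuous, and $H^k(G,A)$ denotes continuous cohomology; an abstract group carries the discrete topology, so that this is ordinary group cohomology. Let $\widehat H$ be the profinite completion of a group $H$. The group $H$ is cohomologically good if for every finite discrete $\widehat H$-module $A$ and every $k\ge 0$ the natural map $H\to\widehat H$ induces an isomorphism $H^k(\widehat H,A)\to H^k(H,A)$. The cohomological dimension $\mathrm{cd}(H)$ of an abstract group $H$ is the least $n\in\mathbb{N}\cup\{0,\infty\}$ such that $H^k(H,A)=0$ for all $k>n$ and all $\mathbb{Z}[H]$-modules $A$. For a profinite group $G$ and a prime $p$, $\mathrm{cd}_p(G)$ is the least $n\in\mathbb{N}\cup\{0,\infty\}$ such that the $p$-primary component of $H^k(G,A)$ vanishes for all $k>n$ and all discrete torsion $G$-modules $A$, and $\mathrm{cd}(G)=\sup\{\mathrm{cd}_p(G)\mid p \text{ prime}\}$. Lemma. Suppose that $H$ is a cohomologically good group with $\mathrm{cd}(H)=n<\infty$. Then $\mathrm{cd}(\widehat H)\le n$, and $\widehat H$ is torsion-free, i.e. it has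 no non-trivial element of finite order. -/

import Mathlib

open CategoryTheory

universe u

noncomputable section

namespace GoodGroups

/-- The profinite completion `Ĥ` of an abstract group `H`. -/
abbrev Completion (H : Type u) [Group H] : ProfiniteGrp.{u} :=
  ProfiniteGrp.ProfiniteCompletion.completion (GrpCat.of H)

/-- The canonical homomorphism `H → Ĥ`. The abstract group `H` carries the discrete topology, so it
is continuous. -/
def toCompletion (H : Type u) [Group H] [TopologicalSpace H] [DiscreteTopology H] :
    H →ₜ* Completion H where
  toMonoidHom := (ProfiniteGrp.ProfiniteCompletion.eta (GrpCat.of H)).hom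
  continuous_toFun := continuous_of_discreteTopology

/-- `A` is a discrete `G`-module: an abelian group with the discrete topology on which `G` acts by
automorphisms such that the action `G × A → A` is continuous. If `G` is discrete, these are
exactly the `ℤ[G]`-modules. -/
structure IsDiscreteModule {G : Type u} [Group G] [TopologicalSpace G]
    (A : TopRep.{u} ℤ G) : Prop where
  discrete : DiscreteTopology A
  continuous_action : Continuous fun x : G × A => A.ρ x.1 x.2

/-- A group `H` (with the discrete topology) is cohomologically good if for every finite discrete
`Ĥ`-module `A` and every `k` the canonical map `H → Ĥ` induces an isomorphism from the (continuous)
cohomology `H^k(Ĥ, A)` to the cohomology `H^k(H, A)`. -/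
def IsCohomologicallyGood (H : Type u) [Group H] [TopologicalSpace H] [DiscreteTopology H] :
    Prop :=
  ∀ A : TopRep.{u} ℤ (Completion H), IsDiscreteModule A → Finite A → ∀ k : ℕ,
    Function.Bijective
      (ContinuousCohomology.map (toCompletion H)
        (𝟙 (TopRep.res (toCompletion H : H →* Completion H) A)) k)

/-- The cohomological dimension of an abstract group `H` (with the discrete topology, so that
continuous cohomology is ordinary group cohomology): the least `n ∈ ℕ ∪ {∞}` with `H^k(H, A) = 0`
for all `k > n` and all `ℤ[H]`-modules `A`. -/
def cd (H : Type u) [Group H] [TopologicalSpace H] [DiscreteTopology H] : ℕ∞ :=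
  sInf {n : ℕ∞ | ∀ k : ℕ, n < k → ∀ A : TopRep.{u} ℤ H, IsDiscreteModule A →
    Subsingleton (continuousCohomology k A)}

/-- The cohomological `p`-dimension of a profinite group `G`: the least `n ∈ ℕ ∪ {∞}` such that for
all `k > n` and all discrete torsion `G`-modules `A` the `p`-primary component of `H^k(G, A)`
vanishes. -/
def profiniteCdAt (p : ℕ) (G : ProfiniteGrp.{u}) : ℕ∞ :=
  sInf {n : ℕ∞ | ∀ k : ℕ, n < k → ∀ A : TopRep.{u} ℤ G, IsDiscreteModule A →
    (∀ a : A, IsOfFinAddOrder a) →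
    ∀ x : continuousCohomology k A, (∃ m : ℕ, p ^ m • x = 0) → x = 0}

/-- The cohomological dimension of a profinite group `G`: the supremum of its cohomological
`p`-dimensions over all primes `p`. -/
def profiniteCd (G : ProfiniteGrp.{u}) : ℕ∞ :=
  ⨆ (p : ℕ) (_ : p.Prime), profiniteCdAt p G

end GoodGroups

end

/-!
The vanishing of the cohomology of `Ĥ` with finite coefficients above degree `n` is read off from
`H` by goodness. A cocycle of a compact group with values in a discrete torsion module takes only
finitely many values, so it lives in a finite submodule; this bounds `cd(Ĥ)`. An element of finite
order of `Ĥ` generates a finite cyclic group `C` that meets some open normal subgroup `U` trivially,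
so that every finite `C`-module can be coinduced to a finite module over `Ĥ / U`, and by Shapiro's
lemma `C` has no cohomology with finite coefficients above degree `n`. Presenting a finite
`C`-module as a quotient of the coinduced one by the norm map shifts this down to degree `1`, where
`H¹(C, C) = Hom(C, C)` shows that `C` is trivial.
-/

noncomputable section

namespace GoodGroups

open scoped Topology

section Coboundary

variable {G G' A B : Type*} [AddCommGroup A] [AddCommGroup B]

/-- The homogeneous coboundary `f(g₁, …, gₙ) - f(g₀, g₂, …, gₙ) + ⋯`. Cochains of all degrees are
encoded as a single function of finite sequences, of which the degree `k` part is the restriction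
to sequences of length `k + 1`. -/
def coboundary : (List G → A) → List G → A
  | _, [] => 0
  | f, g :: l => f l - coboundary (fun w => f (g :: w)) l

@[simp]
lemma coboundary_nil (f : List G → A) : coboundary f [] = 0 := rfl

lemma coboundary_cons (f : List G → A) (g : G) (l : List G) :
    coboundary f (g :: l) = f l - coboundary (fun w => f (g :: w)) l := rfl

lemma coboundary_comp_map (r : G → G') (f : List G' → A) (l : List G) :
    coboundary (fun w => f (w.map r)) l = coboundary f (l.map r) := by
  induction l generalizing f with
  | nil => rfl
  | cons g l ih => simp only [coboundary_cons, List.map_cons, ← ih fun w => f (r g :: w)]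

lemma map_coboundary {F : Type*} [FunLike F A B] [AddMonoidHomClass F A B] (φ : F)
    (f : List G → A) (l : List G) : φ (coboundary f l) = coboundary (fun w => φ (f w)) l := by
  induction l generalizing f with
  | nil => exact map_zero φ
  | cons g l ih => simp only [coboundary_cons, map_sub, ih fun w => f (g :: w)]

lemma coboundary_apply {X : Type*} (f : List G → X → A) (l : List G) (x : X) :
    coboundary f l x = coboundary (fun w => f w x) l :=
  map_coboundary (Pi.evalAddMonoidHom (fun _ : X => A) x) f l

lemma coboundary_zero (l : List G) : coboundary (fun _ => (0 : A)) l = 0 :=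
  (map_coboundary (0 : A →+ A) (fun _ => 0) l).symm

lemma coboundary_sub (f f' : List G → A) (l : List G) :
    coboundary (fun w => f w - f' w) l = coboundary f l - coboundary f' l := by
  induction l generalizing f f' with
  | nil => exact (sub_self 0).symm
  | cons g l ih =>
    simp only [coboundary_cons, ih (fun w => f (g :: w)) fun w => f' (g :: w)]
    abel

lemma coboundary_congr {f f' : List G → A} {l : List G}
    (h : ∀ w, w.length + 1 = l.length → f w = f' w) : coboundary f l = coboundary f' l := by
  induction l generalizing f f' with
  | nil => rfl
  | cons g l ih =>
    rw [coboundary_cons, coboundary_cons, h l rfl, ih fun w hw => h (g :: w) (congrArg _ hw)]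

lemma coboundary_coboundary (f : List G → A) (l : List G) :
    coboundary (coboundary f) l = 0 := by
  induction l generalizing f with
  | nil => rfl
  | cons g l ih => simp [coboundary_cons, coboundary_sub f (coboundary fun w => f (g :: w)), ih]

end Coboundary

section ListTopology

variable {X Y α : Type*} [TopologicalSpace X] [TopologicalSpace Y] [TopologicalSpace α]

lemma continuous_of_nil_of_cons {f : X × List α → Y} (hnil : Continuous fun x => f (x, []))
    (hcons : Continuous fun p : X × α × List α => f (p.1, p.2.1 :: p.2.2)) : Continuous f := by
  rw [continuous_iff_continuousAt]
  rintro ⟨x, _ | ⟨a, l⟩⟩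
  · rw [ContinuousAt, nhds_prod_eq, nhds_nil, Filter.prod_pure, Filter.tendsto_map'_iff]
    exact hnil.tendsto x
  · have hle : 𝓝 (a :: l) ≤ (𝓝 a ×ˢ 𝓝 l).map fun p : α × List α => p.1 :: p.2 :=
      List.tendsto_cons_iff.2 Filter.tendsto_map
    rw [ContinuousAt, nhds_prod_eq]
    refine Filter.Tendsto.mono_left ?_ (Filter.prod_mono_right _ hle)
    rw [← Filter.map_id (f := 𝓝 x), Filter.prod_map_map_eq, Filter.tendsto_map'_iff,
      ← nhds_prod_eq, ← nhds_prod_eq]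
    exact hcons.tendsto (x, a, l)

lemma continuous_listMap {f : X → Y} (hf : Continuous f) : Continuous (List.map f) :=
  continuous_iff_continuousAt.2 <| List.tendsto_nhds (tendsto_pure_nhds _ _)
    fun _ a hl => ((hf.tendsto a).comp Filter.tendsto_fst).cons (hl.comp Filter.tendsto_snd)

lemma isClopen_setOf_length_eq (n : ℕ) : IsClopen {l : List α | l.length = n} :=
  (isClopen_discrete {n}).preimage (continuous_iff_continuousAt.2 List.continuousAt_length)

lemma isCompact_setOf_length_eq [CompactSpace α] (n : ℕ) :
    IsCompact {l : List α | l.length = n} := by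
  induction n with
  | zero => simpa only [List.length_eq_zero_iff] using! isCompact_singleton
  | succ n ih =>
    convert (isCompact_univ.prod ih).image List.continuous_cons
    ext l
    cases l <;> simp

end ListTopology

section Acyclicity

variable {R G A : Type*} [Ring R] [Group G] [AddCommGroup A] [Module R A]

/-- Homogeneous cochains of `G` with values in `A`: functions of finite sequences which are
equivariant for the diagonal left translation. -/
def IsEquivariant (ρ : Representation R G A) (f : List G → A) : Prop :=
  ∀ g l, f (l.map (g * ·)) = ρ g (f l)

lemma map_mul_left_map_mul_left (x c : G) (l : List G) :
    (l.map (c * ·)).map (x * ·) = l.map (x * c * ·) := by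
  simp [Function.comp_def, mul_assoc]

variable {ρ : Representation R G A} {f f' : List G → A}

lemma IsEquivariant.sub (hf : IsEquivariant ρ f) (hf' : IsEquivariant ρ f') :
    IsEquivariant ρ fun l => f l - f' l := fun g l => by
  simp only [hf g l, hf' g l, map_sub]

lemma IsEquivariant.coboundary (hf : IsEquivariant ρ f) :
    IsEquivariant ρ (coboundary f) := fun g l => by
  rw [← coboundary_comp_map, funext (hf g), map_coboundary (ρ g)]

lemma IsEquivariant.map {B : Type*} [AddCommGroup B] [Module R B] {τ : Representation R G B}
    (hf : IsEquivariant ρ f) (φ : ρ.IntertwiningMap τ) : IsEquivariant τ fun l => φ (f l) :=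
  fun g l => by simp only [hf g l, φ.isIntertwining]

variable [TopologicalSpace G] [TopologicalSpace A]

/-- `H^k(G, A) = 0` for `k > 0`, in terms of continuous homogeneous cochains: every `k`-cocycle is
the coboundary of a `(k - 1)`-cochain. For `k = 0`, where a `(-1)`-cochain is an invariant element
of `A`, this always holds. -/
def IsAcyclicAt (ρ : Representation R G A) (k : ℕ) : Prop :=
  ∀ f : List G → A, Continuous f → IsEquivariant ρ f →
    (∀ l, l.length = k + 2 → coboundary f l = 0) →
    ∃ e : List G → A, Continuous e ∧ IsEquivariant ρ e ∧
      ∀ l, l.length = k + 1 → coboundary e l = f l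

lemma IsAcyclicAt.exists_coboundary_eq_of_mem {W : Subrepresentation ρ} {k : ℕ}
    (hW : IsAcyclicAt W.toRepresentation k) (hf : Continuous f) (hfρ : IsEquivariant ρ f)
    (hfc : ∀ l, l.length = k + 2 → coboundary f l = 0)
    (hfW : ∀ l, l.length = k + 1 → f l ∈ W.toSubmodule) :
    ∃ e : List G → W.toSubmodule, Continuous e ∧ IsEquivariant W.toRepresentation e ∧
      ∀ l, l.length = k + 1 → coboundary (fun w => (e w : A)) l = f l := by
  classical
  let t : List G → W.toSubmodule := fun l =>
    if hl : l.length = k + 1 then ⟨f l, hfW l hl⟩ else 0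
  have ht (l : List G) : (t l : A) = Set.piecewise {l | l.length = k + 1} f 0 l := by
    by_cases hl : l.length = k + 1 <;> simp [t, hl]
  have htf (l : List G) (hl : l.length = k + 1) : (t l : A) = f l := by simp [t, hl]
  have htcont : Continuous t := continuous_induced_rng.2 <| by
    rw [show Subtype.val ∘ t = _ from funext ht]
    exact hf.piecewise (by simp [(isClopen_setOf_length_eq (k + 1)).frontier_eq]) continuous_zero
  have htρ : IsEquivariant W.toRepresentation t := fun g l => by
    by_cases hl : l.length = k + 1
    · exact Subtype.ext (by
        rw [htf _ (by simpa using hl), hfρ, ← htf l hl]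
        rfl)
    · simp [t, hl]
  have htc (l : List G) (hl : l.length = k + 2) : coboundary t l = 0 := Subtype.ext <| by
    rw [← Submodule.subtype_apply, map_coboundary, Submodule.coe_zero, ← hfc l hl]
    exact coboundary_congr fun w hw => htf w (by omega)
  obtain ⟨e, he, heρ, hec⟩ := hW t htcont htρ htc
  refine ⟨e, he, heρ, fun l hl => ?_⟩
  rw [← htf l hl, ← hec l hl]
  exact (map_coboundary W.toSubmodule.subtype e l).symm

end Acyclicity

section FiniteGroup

variable {R G A : Type*} [Ring R] [Group G] [AddCommGroup A] [Module R A]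

variable (R G A) in
/-- The action of `G` by right translation on the module of all functions `G → A`, which is the
module coinduced from the trivial subgroup. -/
def funRep : Representation R G (G → A) where
  toFun g := LinearMap.funLeft R A (· * g)
  map_one' := by ext; simp
  map_mul' g h := by ext; simp [mul_assoc]

@[simp]
lemma funRep_apply (g : G) (φ : G → A) (x : G) : funRep R G A g φ x = φ (x * g) := rfl

lemma isAcyclicAt_funRep [TopologicalSpace G] [DiscreteTopology G] [TopologicalSpace A] (k : ℕ) :
    IsAcyclicAt (funRep R G A) k := by
  intro f _ hf hfc
  refine ⟨fun l x => f (1 :: l.map (x * ·)) 1, continuous_of_discreteTopology,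
    fun c l => funext fun x => ?_, fun l hl => funext fun x => ?_⟩
  · simp only [funRep_apply, map_mul_left_map_mul_left]
  · have hcocycle := congrFun (hfc (1 :: l.map (x * ·)) (by simp [hl])) 1
    rw [coboundary_cons, Pi.sub_apply, Pi.zero_apply, sub_eq_zero, hf x l, funRep_apply,
      one_mul] at hcocycle
    calc coboundary (fun w y => f (1 :: w.map (y * ·)) 1) l x
        = coboundary (fun w => f (1 :: w.map (x * ·)) 1) l := coboundary_apply _ l x
      _ = coboundary (fun w => f (1 :: w) 1) (l.map (x * ·)) :=
          coboundary_comp_map (x * ·) (fun w => f (1 :: w) 1) l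
      _ = coboundary (fun w => f (1 :: w)) (l.map (x * ·)) 1 := (coboundary_apply _ _ 1).symm
      _ = f l x := hcocycle.symm

variable [Fintype G]

/-- The norm map `φ ↦ ∑ x, x⁻¹ φ(x)`, which presents `A` as an equivariant quotient of the
coinduced module `G → A`. -/
def normMap (ρ : Representation R G A) : (funRep R G A).IntertwiningMap ρ where
  toLinearMap := ∑ x, ρ x⁻¹ ∘ₗ LinearMap.proj x
  isIntertwining' g := by
    ext φ
    simp only [LinearMap.comp_apply, LinearMap.sum_apply, LinearMap.proj_apply, map_sum]
    exact Fintype.sum_equiv (Equiv.mulRight g) _ _ fun x => by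
      simp [← Module.End.mul_apply, ← map_mul]

lemma normMap_apply (ρ : Representation R G A) (φ : G → A) :
    normMap ρ φ = ∑ x, ρ x⁻¹ (φ x) := by
  rw [← Representation.IntertwiningMap.toLinearMap_apply]
  simp [normMap, LinearMap.sum_apply]

open Classical in
lemma IsEquivariant.exists_normMap_eq {ρ : Representation R G A} {f : List G → A}
    (hf : IsEquivariant ρ f) :
    ∃ s : List G → G → A, IsEquivariant (funRep R G A) s ∧
      ∀ l, l ≠ [] → normMap ρ (s l) = f l := by
  -- The value on `(g₀, …, gₙ)` is the lift of `f(g₀, …, gₙ)` supported at `g₀⁻¹`.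
  refine ⟨fun l x => if l.head? = some x⁻¹ then ρ x (f l) else 0,
    fun g l => funext fun x => ?_, fun l hl => ?_⟩
  · have hhead : (l.map (g * ·)).head? = some x⁻¹ ↔ l.head? = some (x * g)⁻¹ := by
      cases l <;> simp [eq_inv_mul_iff_mul_eq]
    simp only [funRep_apply, hhead, hf g l, map_mul, Module.End.mul_apply]
  · obtain ⟨g, l, rfl⟩ := List.exists_cons_of_ne_nil hl
    rw [normMap_apply, Finset.sum_eq_single g⁻¹ (fun x _ hx => ?_) (by simp)]
    · simp
    · have hg : g ≠ x⁻¹ := fun h => hx (by rw [h, inv_inv])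
      simp [hg]

lemma isAcyclicAt_of_isAcyclicAt_ker_normMap [TopologicalSpace G] [DiscreteTopology G]
    [TopologicalSpace A] {ρ : Representation R G A} {k : ℕ}
    (h : IsAcyclicAt (normMap ρ).ker.toRepresentation (k + 1)) : IsAcyclicAt ρ k := by
  intro f _ hf hfc
  obtain ⟨s, hs, hsf⟩ := hf.exists_normMap_eq
  have hker (l : List G) (hl : l.length = k + 2) :
      coboundary s l ∈ (normMap ρ).ker.toSubmodule := by
    change normMap ρ _ = 0
    rw [map_coboundary, ← hfc l hl]
    exact coboundary_congr fun w hw => hsf w (by rintro rfl; simp [hl] at hw)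
  obtain ⟨e, -, he, hes⟩ := h.exists_coboundary_eq_of_mem continuous_of_discreteTopology
    hs.coboundary (fun l _ => coboundary_coboundary s l) hker
  obtain ⟨e', -, he', hee'⟩ := isAcyclicAt_funRep (A := A) k (fun l => s l - e l)
    continuous_of_discreteTopology (hs.sub fun g l => by rw [he g l]; rfl) fun l hl => by
      rw [coboundary_sub, hes l hl, sub_self]
  refine ⟨fun l => normMap ρ (e' l), continuous_of_discreteTopology, he'.map _, fun l hl => ?_⟩
  have hel : normMap ρ (e l : G → A) = 0 := (e l).2
  rw [← map_coboundary, hee' l hl, map_sub, hel, sub_zero, hsf l (by rintro rfl; simp at hl)]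

end FiniteGroup

lemma eq_zero_of_isAcyclicAt_trivial {R G A : Type*} [Ring R] [Group G] [AddCommGroup A]
    [Module R A] [TopologicalSpace G] [DiscreteTopology G] [TopologicalSpace A]
    (h : IsAcyclicAt (Representation.trivial R G A) 1) (φ : Additive G →+ A) : φ = 0 := by
  let f : List G → A
    | [x, y] => φ (.ofMul (x⁻¹ * y))
    | _ => 0
  have hf : IsEquivariant (Representation.trivial R G A) f := fun g l => by
    rcases l with _ | ⟨x, _ | ⟨y, _ | ⟨z, l⟩⟩⟩ <;> simp [f]
  have hfc (l : List G) (hl : l.length = 3) : coboundary f l = 0 := by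
    obtain ⟨x, y, z, rfl⟩ := List.length_eq_three.1 hl
    simp only [coboundary_cons, coboundary_nil, f, ofMul_mul, ofMul_inv, map_add, map_neg]
    abel
  obtain ⟨e, -, he, hef⟩ := h f continuous_of_discreteTopology hf hfc
  ext c
  calc φ (.ofMul c) = coboundary e [1, c] := by simp [hef, f]
    _ = e ([1].map (c * ·)) - e [1] := by simp [coboundary_cons]
    _ = 0 := by rw [he c [1], Representation.trivial_apply, sub_self]

section Homology

variable {R : Type*} [Ring R] [TopologicalSpace R]

/-- The homology of a complex of topological modules, presented as kernel modulo image. -/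
def topModuleHomologyData (S : ShortComplex (TopModuleCat R)) : S.LeftHomologyData :=
  ⟨_, _, _, _, _, TopModuleCat.isLimitKer _, by simp, TopModuleCat.isColimitCoker _⟩

lemma subsingleton_homology_iff (S : ShortComplex (TopModuleCat R)) :
    Subsingleton S.homology ↔ ∀ x, S.g.hom x = 0 → ∃ y, S.f.hom y = x := by
  let D := topModuleHomologyData S
  have hf (y : S.X₁) : (show S.g.hom.ker from D.f'.hom y).1 = S.f.hom y :=
    congr($(D.f'_i).hom y)
  have e := ((forget (TopModuleCat R)).mapIso D.homologyIso).toEquiv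
  rw [show Subsingleton S.homology ↔ Subsingleton (D.K ⧸ D.f'.hom.range) from
    e.subsingleton_congr, Submodule.Quotient.subsingleton_iff, LinearMap.range_eq_top]
  constructor
  · intro h x hx
    obtain ⟨y, hy⟩ := h ⟨x, hx⟩
    exact ⟨y, (hf y).symm.trans (congrArg Subtype.val hy)⟩
  · rintro h ⟨x, hx⟩
    obtain ⟨y, hy⟩ := h x hx
    exact ⟨y, Subtype.ext ((hf y).trans hy)⟩

end Homology

section ContinuousCohomology

open TopRep

variable {R : Type*} [Ring R] [TopologicalSpace R]
variable {G : Type u} [Group G] [TopologicalSpace G] [IsTopologicalGroup G] (A : TopRep.{u} R G)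

lemma subsingleton_continuousCohomology_iff (k : ℕ) :
    Subsingleton (continuousCohomology (k + 1) A) ↔
      ∀ f ∈ (resolutionX A (k + 2)).ρ.invariants, (d A (k + 2)).hom f = 0 →
        ∃ e ∈ (resolutionX A (k + 1)).ρ.invariants, (d A (k + 1)).hom e = f := by
  let K := homogeneousCochains A
  have e := ((forget (TopModuleCat R)).mapIso
    (K.homologyIsoSc' k (k + 1) (k + 2) (by simp) (by simp))).toEquiv
  rw [show Subsingleton (continuousCohomology (k + 1) A) ↔
    Subsingleton (K.sc' k (k + 1) (k + 2)).homology from e.subsingleton_congr,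
    subsingleton_homology_iff]
  constructor
  · intro h f hf hfd
    obtain ⟨y, hy⟩ := h ⟨f, hf⟩ (Subtype.ext
      ((homogeneousCochains.d_apply A (k + 1) ⟨f, hf⟩).trans hfd))
    exact ⟨y.1, y.2, (homogeneousCochains.d_apply A k y).symm.trans (congrArg Subtype.val hy)⟩
  · rintro h ⟨f, hf⟩ hfd
    obtain ⟨y, hy, hyf⟩ := h f hf ((homogeneousCochains.d_apply A (k + 1) ⟨f, hf⟩).symm.trans
      (congrArg Subtype.val hfd))
    exact ⟨⟨y, hy⟩, Subtype.ext ((homogeneousCochains.d_apply A k ⟨y, hy⟩).trans hyf)⟩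

/-- The value of an element of `C(G, C(G, …, C(G, A)))` on a sequence of elements of `G`, with the
junk value `0` on sequences of the wrong length. -/
def evalList : (n : ℕ) → resolutionX A n → List G → A
  | 0, a, [] => a
  | 0, _, _ :: _ => 0
  | _ + 1, _, [] => 0
  | n + 1, f, g :: l => evalList n ((f : C(G, resolutionX A n)) g) l

lemma evalList_succ_cons (n : ℕ) (f : C(G, resolutionX A n)) (g : G) (l : List G) :
    evalList A (n + 1) f (g :: l) = evalList A n (f g) l := rfl

variable {A}

lemma evalList_ext {n : ℕ} {f f' : resolutionX A n}
    (h : ∀ l, l.length = n → evalList A n f l = evalList A n f' l) : f = f' := by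
  induction n with
  | zero => exact h [] rfl
  | succ n ih => exact ContinuousMap.ext fun g => ih fun l hl => h (g :: l) (congrArg _ hl)

lemma evalList_sub {n : ℕ} (f f' : resolutionX A n) (l : List G) :
    evalList A n (f - f') l = evalList A n f l - evalList A n f' l := by
  induction n generalizing l with
  | zero => cases l <;> simp [evalList]
  | succ n ih =>
    cases l with
    | nil => exact (sub_self 0).symm
    | cons g l => exact ih _ _ l

lemma evalList_zero {n : ℕ} (l : List G) : evalList A n 0 l = 0 := by
  rw [← sub_self (0 : resolutionX A n), evalList_sub, sub_self]

lemma evalList_map_mul {n : ℕ} (x : G) (f : resolutionX A n) (l : List G) :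
    evalList A n ((resolutionX A n).ρ x f) (l.map (x * ·)) = A.ρ x (evalList A n f l) := by
  induction n generalizing l with
  | zero => cases l <;> simp [evalList]
  | succ n ih =>
    cases l with
    | nil => exact (map_zero _).symm
    | cons g l =>
      rw [List.map_cons, evalList_succ_cons, evalList_succ_cons, ← ih]
      congr 1
      exact (ContRepresentation.coind₁_apply_apply _ _ _ _).trans (by simp)

lemma evalList_d {n : ℕ} (f : resolutionX A n) (l : List G) :
    evalList A (n + 1) ((d A n).hom f) l = coboundary (evalList A n f) l := by
  induction n generalizing l with
  | zero =>
    rcases l with _ | ⟨g, _ | ⟨h, l⟩⟩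
    · rfl
    · exact (sub_zero _).symm
    · rw [coboundary_cons, evalList_succ_cons]
      simp only [evalList, coboundary_zero, sub_zero]
  | succ n ih =>
    cases l with
    | nil => rfl
    | cons g l =>
      rw [evalList_succ_cons, coboundary_cons]
      exact (evalList_sub _ _ l).trans (congrArg _ (ih _ l))

lemma continuous_evalList [LocallyCompactSpace G] (n : ℕ) :
    Continuous fun p : resolutionX A n × List G => evalList A n p.1 p.2 := by
  induction n with
  | zero => exact continuous_of_nil_of_cons continuous_id continuous_const
  | succ n ih =>
    refine continuous_of_nil_of_cons continuous_const ?_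
    have heval : Continuous fun p : C(G, resolutionX A n) × G × List G => (p.1 p.2.1, p.2.2) := by
      fun_prop
    exact ih.comp heval

lemma exists_evalList_eq {X : Type u} [TopologicalSpace X] {n : ℕ} {f : X × List G → A}
    (hf : Continuous f) :
    ∃ F : C(X, resolutionX A n), ∀ x l, l.length = n → evalList A n (F x) l = f (x, l) := by
  induction n generalizing X with
  | zero =>
    refine ⟨⟨fun x => f (x, []), by fun_prop⟩, fun x l hl => ?_⟩
    rw [List.length_eq_zero_iff.1 hl]
    rfl
  | succ n ih =>
    have hcons : Continuous fun p : (X × G) × List G => (p.1.1, p.1.2 :: p.2) :=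
      (continuous_fst.comp continuous_fst).prodMk <|
        List.continuous_cons.comp ((continuous_snd.comp continuous_fst).prodMk continuous_snd)
    obtain ⟨F, hF⟩ := ih (hf.comp hcons)
    refine ⟨F.curry, fun x l hl => ?_⟩
    obtain ⟨g, l, rfl⟩ := List.exists_cons_of_length_eq_add_one hl
    exact hF (x, g) l (by simpa using hl)

lemma exists_invariant_evalList_eq {n : ℕ} {f : List G → A} (hf : Continuous f)
    (hfA : IsEquivariant A.ρ.toRepresentation f) :
    ∃ F ∈ (resolutionX A n).ρ.invariants, ∀ l, l.length = n → evalList A n F l = f l := by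
  obtain ⟨F, hF⟩ := exists_evalList_eq (X := PUnit) (n := n) (hf.comp continuous_snd)
  refine ⟨F ⟨⟩, (ContRepresentation.mem_invariants _).2 fun g => evalList_ext fun l hl => ?_,
    hF ⟨⟩⟩
  have hl' : l = (l.map (g⁻¹ * ·)).map (g * ·) := by simp [Function.comp_def]
  rw [hF ⟨⟩ l hl, hl', evalList_map_mul, hF ⟨⟩ _ (by simpa using hl)]
  exact (hfA g _).symm

lemma isEquivariant_evalList {n : ℕ} {F : resolutionX A n}
    (hF : F ∈ (resolutionX A n).ρ.invariants) :
    IsEquivariant A.ρ.toRepresentation (evalList A n F) := fun g l => by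
  conv_lhs => rw [← (ContRepresentation.mem_invariants _).1 hF g]
  exact evalList_map_mul g F l

theorem subsingleton_continuousCohomology_iff_isAcyclicAt [LocallyCompactSpace G] (k : ℕ) :
    Subsingleton (continuousCohomology (k + 1) A) ↔
      IsAcyclicAt A.ρ.toRepresentation (k + 1) := by
  have hcont {n : ℕ} (F : resolutionX A n) : Continuous (evalList A n F) :=
    (continuous_evalList n).comp (.prodMk_right F)
  rw [subsingleton_continuousCohomology_iff]
  constructor
  · intro h f hf hfA hfc
    obtain ⟨F, hFA, hF⟩ := exists_invariant_evalList_eq (n := k + 2) hf hfA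
    obtain ⟨E, hEA, hEF⟩ := h F hFA <| evalList_ext fun l hl => by
      rw [evalList_d, evalList_zero, ← hfc l hl]
      exact coboundary_congr fun w hw => hF w (by omega)
    refine ⟨evalList A _ E, hcont E, isEquivariant_evalList hEA, fun l hl => ?_⟩
    rw [← evalList_d, hEF, hF l hl]
  · intro h F hFA hFc
    obtain ⟨e, he, heA, hef⟩ := h _ (hcont F) (isEquivariant_evalList hFA)
      fun l _ => by rw [← evalList_d, hFc, evalList_zero]
    obtain ⟨E, hEA, hE⟩ := exists_invariant_evalList_eq (n := k + 1) he heA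
    refine ⟨E, hEA, evalList_ext fun l hl => ?_⟩
    rw [evalList_d, ← hef l hl]
    exact coboundary_congr fun w hw => hE w (by omega)

end ContinuousCohomology

section FiniteCoefficients

variable {R : Type*} [Ring R]

variable (R) in
/-- `H^k(G, A) = 0` for all finite discrete `G`-modules `A` over `R` (when `k > 0`), in the sense of
`IsAcyclicAt`. -/
def IsAcyclicOnFinite (G : Type u) [Group G] [TopologicalSpace G] (k : ℕ) : Prop :=
  ∀ (A : Type u) [AddCommGroup A] [Module R A] [TopologicalSpace A] [DiscreteTopology A]
    [Finite A] (ρ : Representation R G A), (Continuous fun x : G × A => ρ x.1 x.2) →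
    IsAcyclicAt ρ k

lemma IsAcyclicOnFinite.of_le {C : Type u} [Group C] [Finite C] [TopologicalSpace C]
    [DiscreteTopology C] {k n : ℕ} (h : IsAcyclicOnFinite R C n) (hk : k ≤ n) :
    IsAcyclicOnFinite R C k := by
  have := Fintype.ofFinite C
  induction hk using Nat.decreasingInduction with
  | self => exact h
  | of_succ k _ ih =>
    intro A _ _ _ _ _ ρ _
    exact isAcyclicAt_of_isAcyclicAt_ker_normMap (ih _ _ continuous_of_discreteTopology)

variable {G : Type u} [Group G] [TopologicalSpace G]

/-- A representation on a discrete module, as a topological representation. -/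
def discreteRep [TopologicalSpace R] [DiscreteTopology R] {A : Type u} [AddCommGroup A]
    [Module R A] [TopologicalSpace A] [DiscreteTopology A] (ρ : Representation R G A) :
    TopRep.{u} R G :=
  have : ContinuousSMul R A := ⟨continuous_of_discreteTopology⟩
  .of <| .ofMonoidHom
    { toFun g := ⟨ρ g, continuous_of_discreteTopology⟩
      map_one' := by ext; simp
      map_mul' g h := by ext; simp }

lemma isAcyclicOnFinite_of_subsingleton [IsTopologicalGroup G] [LocallyCompactSpace G] {k : ℕ}
    (h : ∀ A : TopRep.{u} ℤ G, IsDiscreteModule A → Finite A →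
      Subsingleton (continuousCohomology (k + 1) A)) : IsAcyclicOnFinite ℤ G (k + 1) :=
  fun _ _ _ _ hA hfin ρ hρ =>
    (subsingleton_continuousCohomology_iff_isAcyclicAt (A := discreteRep ρ) k).1
      (h (discreteRep ρ) ⟨hA, hρ⟩ hfin)

lemma IsAcyclicOnFinite.isAcyclicAt_of_torsion [CompactSpace G] [Module.Finite ℤ R]
    {k : ℕ} (h : IsAcyclicOnFinite R G k) {A : Type u} [AddCommGroup A] [Module R A]
    [TopologicalSpace A] [DiscreteTopology A] {ρ : Representation R G A}
    (hρ : Continuous fun x : G × A => ρ x.1 x.2) (htor : ∀ a : A, IsOfFinAddOrder a) :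
    IsAcyclicAt ρ k := by
  intro f hf hfρ hfc
  let V : Set A := f '' {l | l.length = k + 1}
  have hV : V.Finite := ((isCompact_setOf_length_eq _).image hf).finite_of_discrete
  have hmaps (g : G) : Submodule.span R V ≤ (Submodule.span R V).comap (ρ g) := by
    rw [Submodule.span_le]
    rintro _ ⟨l, hl, rfl⟩
    exact Submodule.subset_span ⟨l.map (g * ·), by simpa using hl, hfρ g l⟩
  let W : Subrepresentation ρ := ⟨Submodule.span R V, hmaps⟩
  have : Finite W.toSubmodule := by
    have : Module.Finite R W.toSubmodule := .span_of_finite R hV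
    have : Module.Finite ℤ W.toSubmodule := .trans R _
    have : AddGroup.FG W.toSubmodule := Module.Finite.iff_addGroup_fg.1 this
    exact AddCommGroup.finite_of_fg_isAddTorsion _ fun a =>
      (AddSubmonoid.isOfFinAddOrder_coe (H := W.toSubmodule.toAddSubmonoid)).1 (htor a)
  have hW : Continuous fun x : G × W.toSubmodule => W.toRepresentation x.1 x.2 :=
    continuous_induced_rng.2 <| hρ.comp <| continuous_fst.prodMk <|
      continuous_subtype_val.comp continuous_snd
  obtain ⟨e, he, heW, hef⟩ := (h _ _ hW).exists_coboundary_eq_of_mem hf hfρ hfc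
    fun l hl => Submodule.subset_span ⟨l, hl, rfl⟩
  exact ⟨fun l => e l, continuous_subtype_val.comp he, fun g l => congrArg Subtype.val (heW g l),
    hef⟩

lemma IsAcyclicOnFinite.subsingleton_continuousCohomology_of_torsion [TopologicalSpace R]
    [IsTopologicalGroup G] [CompactSpace G] [Module.Finite ℤ R] {k : ℕ}
    (h : IsAcyclicOnFinite R G (k + 1)) {A : TopRep.{u} R G} [DiscreteTopology A]
    (hA : Continuous fun x : G × A => A.ρ x.1 x.2) (htor : ∀ a : A, IsOfFinAddOrder a) :
    Subsingleton (continuousCohomology (k + 1) A) :=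
  (subsingleton_continuousCohomology_iff_isAcyclicAt k).2 (h.isAcyclicAt_of_torsion hA htor)

end FiniteCoefficients

section Shapiro

lemma exists_equivariant_retraction {C Q : Type*} [Group C] [Group Q] {j : C →* Q}
    (hj : Function.Injective j) : ∃ r : Q → C, (∀ c x, r (j c * x) = c * r x) ∧ r 1 = 1 := by
  obtain ⟨S, hS, -⟩ := j.range.exists_isComplement_right 1
  let e := MonoidHom.ofInjective hj
  let s : Q → C := fun x => e.symm (hS.equiv x).1
  have hs (c : C) (x : Q) : s (j c * x) = c * s x := by
    simp only [s, show j c = (e c : Q) from rfl, hS.equiv_mul_left (e c) x, map_mul,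
      MulEquiv.symm_apply_apply]
  exact ⟨fun x => s x * (s 1)⁻¹, fun c x => by simp only [hs, mul_assoc], mul_inv_cancel _⟩

variable {R : Type*} [Ring R]

lemma isAcyclicAt_of_isAcyclicAt_coind {C G Q A : Type*} [Group C] [Group G] [Group Q]
    [AddCommGroup A] [Module R A] [TopologicalSpace C] [DiscreteTopology C] [TopologicalSpace G]
    [TopologicalSpace Q] [DiscreteTopology Q] [TopologicalSpace A]
    {j : C →* G} {q : G →* Q} (hq : Continuous q) (hqj : Function.Injective (q.comp j))
    {σ : Representation R C A} {k : ℕ}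
    (h : IsAcyclicAt ((Representation.coind (q.comp j) σ).comp q) k) : IsAcyclicAt σ k := by
  intro f _ hf hfc
  -- The inverse of Shapiro's map `e ↦ ev 1 ∘ e ∘ j` is induced by a retraction `r` of `Q` onto `C`.
  obtain ⟨r, hr, hr1⟩ := exists_equivariant_retraction hqj
  have hrj (c : C) : r (q (j c)) = c := by simpa [hr1] using hr c 1
  let F : List Q → Representation.coindV (q.comp j) σ := fun l =>
    ⟨fun x => f (l.map fun y => r (x * y)), fun c x => by
      simp only [mul_assoc, hr, ← hf c, List.map_map, Function.comp_def]⟩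
  let ev (x : Q) : Representation.coindV (q.comp j) σ →ₗ[R] A :=
    LinearMap.proj x ∘ₗ Submodule.subtype _
  have hFc (l : List Q) (x : Q) :
      ev x (coboundary F l) = coboundary f (l.map fun y => r (x * y)) :=
    (map_coboundary (ev x) F l).trans (coboundary_comp_map _ f l)
  obtain ⟨e, -, he, hef⟩ := h (fun l => F (l.map q))
    ((continuous_of_discreteTopology (f := F)).comp (continuous_listMap hq))
    (fun g l => Subtype.ext <| funext fun x => by
      change f _ = f _
      simp [Function.comp_def, mul_assoc])
    (fun l hl => Subtype.ext <| funext fun x => by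
      rw [coboundary_comp_map]
      exact (hFc _ x).trans (hfc _ (by simpa using hl)))
  refine ⟨fun l => ev 1 (e (l.map j)), continuous_of_discreteTopology, fun c l => ?_,
    fun l hl => ?_⟩
  · calc ev 1 (e ((l.map (c * ·)).map j)) = ev 1 (e ((l.map j).map (j c * ·))) := by
          simp only [List.map_map, Function.comp_def, map_mul]
      _ = (e (l.map j)).1 (1 * q (j c)) := congrArg (ev 1) (he _ _)
      _ = (e (l.map j)).1 (q (j c) * 1) := by rw [one_mul, mul_one]
      _ = σ c (ev 1 (e (l.map j))) := (e (l.map j)).2 c 1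
  · rw [coboundary_comp_map j fun w => ev 1 (e w), ← map_coboundary, hef _ (by simpa using hl)]
    simp [ev, F, Function.comp_def, hrj]

variable {G : Type u} [Group G] [TopologicalSpace G] [IsTopologicalGroup G] [CompactSpace G]

lemma IsAcyclicOnFinite.of_openNormalSubgroup {k : ℕ} (h : IsAcyclicOnFinite R G k) {C : Type u}
    [Group C] [TopologicalSpace C] [DiscreteTopology C] {j : C →* G} (U : OpenNormalSubgroup G)
    (hj : ∀ c, j c ∈ U → c = 1) : IsAcyclicOnFinite R C k := by
  intro A _ _ _ _ _ σ _
  have hqj : Function.Injective ((QuotientGroup.mk' U.toSubgroup).comp j) :=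
    (injective_iff_map_eq_one _).2 fun c hc => hj c ((QuotientGroup.eq_one_iff _).1 hc)
  have hq : Continuous (QuotientGroup.mk' U.toSubgroup) := QuotientGroup.continuous_mk
  refine isAcyclicAt_of_isAcyclicAt_coind hq hqj (h _ _ ?_)
  let τ := Representation.coind ((QuotientGroup.mk' U.toSubgroup).comp j) σ
  exact (continuous_of_discreteTopology (f := fun x : (G ⧸ U.toSubgroup) × _ => τ x.1 x.2)).comp
    (hq.prodMap continuous_id)

end Shapiro

section Profinite

lemma eq_one_of_isOfFinOrder {G : Type u} [Group G] [TopologicalSpace G] [IsTopologicalGroup G]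
    [CompactSpace G] [TotallyDisconnectedSpace G] {n : ℕ} (h : IsAcyclicOnFinite ℤ G (n + 1))
    {g : G} (hg : IsOfFinOrder g) : g = 1 := by
  have : Finite (Subgroup.zpowers g) := hg.finite_zpowers
  obtain ⟨U, hU⟩ := ProfiniteGrp.exist_openNormalSubgroup_sub_open_nhds_of_one
    (((Subgroup.zpowers g : Set G) \ {1}).toFinite.isClosed.isOpen_compl) (by simp)
  have hj (c : Subgroup.zpowers g) (hc : (c : G) ∈ U) : c = 1 := by
    by_contra hc1
    exact hU hc ⟨c.2, by simpa using hc1⟩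
  have hC : IsAcyclicOnFinite ℤ (Subgroup.zpowers g) 1 :=
    (h.of_openNormalSubgroup (j := (Subgroup.zpowers g).subtype) U hj).of_le (Nat.le_add_left 1 n)
  let : CommGroup (Subgroup.zpowers g) := { mul_comm := Std.Commutative.comm }
  have hid : AddMonoidHom.id (Additive (Subgroup.zpowers g)) = 0 :=
    eq_zero_of_isAcyclicAt_trivial (hC _ (.trivial ℤ _ _) continuous_of_discreteTopology) _
  exact congrArg Subtype.val (DFunLike.congr_fun hid (.ofMul ⟨g, Subgroup.mem_zpowers g⟩))

lemma profiniteCd_le {G : ProfiniteGrp.{u}} {n : ℕ} (h : ∀ k, n < k → IsAcyclicOnFinite ℤ G k) :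
    profiniteCd G ≤ n := by
  refine iSup₂_le fun p _ => sInf_le fun k hk A hA htor x _ => ?_
  obtain ⟨k, rfl⟩ := Nat.exists_eq_add_one_of_ne_zero (Nat.ne_zero_of_lt (Nat.cast_lt.1 hk))
  have := hA.discrete
  have := (h _ (Nat.cast_lt.1 hk)).subsingleton_continuousCohomology_of_torsion
    hA.continuous_action htor
  exact Subsingleton.elim _ _

end Profinite

section Comparison

variable {H : Type u} [Group H] [TopologicalSpace H] [DiscreteTopology H]

lemma subsingleton_continuousCohomology_of_cd_lt {k : ℕ} (hk : cd H < k) {A : TopRep.{u} ℤ H}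
    (hA : IsDiscreteModule A) : Subsingleton (continuousCohomology k A) :=
  csInf_mem (s := {n : ℕ∞ | ∀ k : ℕ, n < k → ∀ A : TopRep.{u} ℤ H, IsDiscreteModule A →
    Subsingleton (continuousCohomology k A)}) ⟨⊤, fun _ hk => absurd hk not_top_lt⟩ k hk A hA

lemma IsDiscreteModule.res {G G' : Type u} [Group G] [TopologicalSpace G] [Group G']
    [TopologicalSpace G'] {A : TopRep.{u} ℤ G'} (hA : IsDiscreteModule A) (φ : G →ₜ* G') :
    IsDiscreteModule (TopRep.res (φ : G →* G') A) where
  discrete := hA.discrete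
  continuous_action := hA.continuous_action.comp (φ.continuous_toFun.prodMap continuous_id)

end Comparison

end GoodGroups

end

open GoodGroups in
theorem lemma3p3_general {H : Type u} [Group H] [TopologicalSpace H] [DiscreteTopology H]
    {G : ProfiniteGrp.{u}} (φ : H →ₜ* G) (n : ℕ)
    (hφ : ∀ A : TopRep.{u} ℤ G, IsDiscreteModule A → Finite A → ∀ k : ℕ, n < k →
      Function.Injective (ContinuousCohomology.map φ (𝟙 (TopRep.res (φ : H →* G) A)) k))
    (hcd : cd H ≤ n) : profiniteCd G ≤ n ∧ ∀ g : G, IsOfFinOrder g → g = 1 := by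
  have hvan (k : ℕ) (hk : n < k) : IsAcyclicOnFinite ℤ G k := by
    obtain ⟨k, rfl⟩ := Nat.exists_eq_add_one_of_ne_zero (Nat.ne_zero_of_lt hk)
    refine isAcyclicOnFinite_of_subsingleton fun A hA hfin => ?_
    have := subsingleton_continuousCohomology_of_cd_lt (hcd.trans_lt (Nat.cast_lt.2 hk)) (hA.res φ)
    exact (hφ A hA hfin _ hk).subsingleton
  exact ⟨profiniteCd_le hvan, fun _ => eq_one_of_isOfFinOrder (hvan _ n.lt_succ_self)⟩

theorem lemma3p3 {H : Type u} [Group H] [TopologicalSpace H] [DiscreteTopology H] (n : ℕ)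
    (hgood : GoodGroups.IsCohomologicallyGood H) (hcd : GoodGroups.cd H = n) :
    GoodGroups.profiniteCd (GoodGroups.Completion H) ≤ n ∧
      ∀ g : GoodGroups.Completion H, IsOfFinOrder g → g = 1 :=
  lemma3p3_general (GoodGroups.toCompletion H) n
    (fun A hA hfin k _ => (hgood A hA hfin k).injective) hcd.le
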